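/- Let $(\Omega,\mathcal F,P)$ be a probability space, let $(\varepsilon_i)_{i\ge1}$ be real random variables on it and let $b=(b_i)_{i\ge1}$ be a real sequence. Assume that 1. the $\varepsilon_i$ are square-integrable and independent, with $E(\varepsilon_i)=0$ and $E(\varepsilon_i^2)=1$ for all $i\ge1$; 2. $b\in\ell_2$, i.e. $\sum_{i\ge1}b_i^2<\infty$; 3. $P(\varepsilon_i>b_i)>0$ and $P(\varepsilon_i<b_i)>0$ for all $i\ge1$; 4. $\sup_{i\ge1}E(|\varepsilon_i|^3)<\infty$. For $z\in\mathbb R$ and $h\in\ell_2$ let $V^{z,h}:=z+\sum_{i=1}^\infty h_i(\varepsilon_i-b_i)$, where the infinite sum is the limit in $L^2(P)$ of its partial sums. Let $K^z:=\{V^{z,h}: h\in\ell_2\}\subset L^2(P)$, let $L^2_+(P)$ be the set of almost surely nonnegative elements of $L^2(P)$, and let $$C^z:=K^z-L^2_+(P)=\{V-\kappa:\ V\in K^z,\ \kappa\in L^2_+(P)\}.$$ Then, for every $z\in\mathbb R$, the set $C^z$ is closed in probability in $L^2(P)$: if $(\theta_n)_{n\ge1}$ is a sequence in $C^z$ that converges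 in probability to some $\theta\in L^2(P)$, then $\theta\in C^z$. -/

import Mathlib

open MeasureTheory ProbabilityTheory Filter Topology
open scoped ENNReal Pointwise

namespace LargeMarket

variable {Ω : Type*} [MeasurableSpace Ω]

/-- The random sources `ε i` are square-integrable, independent random variables with mean `0` and
variance `1`. The sources are indexed by `ℕ`, in place of `{1, 2, 3, …}`. -/
structure StandardizedSources (P : Measure Ω) (ε : ℕ → Ω → ℝ) : Prop where
  measurable : ∀ i, Measurable (ε i)
  square_integrable : ∀ i, MemLp (ε i) 2 P
  indep : iIndepFun ε P
  mean_zero : ∀ i, ∫ ω, ε i ω ∂P = 0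
  second_moment : ∀ i, ∫ ω, ε i ω ^ 2 ∂P = 1

/-- `P(ε i > b i) > 0` and `P(ε i < b i) > 0` for every `i`. -/
def NoSourceArbitrage (P : Measure Ω) (ε : ℕ → Ω → ℝ) (b : ℕ → ℝ) : Prop :=
  ∀ i, 0 < P {ω | b i < ε i ω} ∧ 0 < P {ω | ε i ω < b i}

/-- `sup_i E(|ε i|³) < ∞`. -/
def BoundedThirdMoments (P : Measure Ω) (ε : ℕ → Ω → ℝ) : Prop :=
  ⨆ i, ∫⁻ ω, ‖ε i ω‖ₑ ^ 3 ∂P < ∞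

/-- The value `x + ∑_{i < n} h i * (ε i - b i)` of a portfolio in the first `n` sources. -/
def finiteValue (ε : ℕ → Ω → ℝ) (b : ℕ → ℝ) (x : ℝ) (h : ℕ → ℝ) (n : ℕ) (ω : Ω) : ℝ :=
  x + ∑ i ∈ Finset.range n, h i * (ε i ω - b i)

/-- `V` is the value `x + ∑_i h i * (ε i - b i)` of the strategy `h` from initial wealth `x`, the
infinite sum being the limit in `L²(P)` of its partial sums. -/
def IsValue (P : Measure Ω) (ε : ℕ → Ω → ℝ) (b : ℕ → ℝ) (x : ℝ) (h : ℕ → ℝ)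
    (V : Lp ℝ 2 P) : Prop :=
  Tendsto (fun n => eLpNorm (fun ω => finiteValue ε b x h n ω - V ω) 2 P) atTop (𝓝 0)

/-- The set `K^x` of the values of all strategies in `ℓ₂` from initial wealth `x`. -/
def attainable (P : Measure Ω) (ε : ℕ → Ω → ℝ) (b : ℕ → ℝ) (x : ℝ) : Set (Lp ℝ 2 P) :=
  {V | ∃ h : lp (fun _ : ℕ => ℝ) 2, IsValue P ε b x h V}

/-- The cone `L²₊(P)` of the almost surely nonnegative elements of `L²(P)`. -/
def nonnegL2 (P : Measure Ω) : Set (Lp ℝ 2 P) :=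
  {κ | ∀ᵐ ω ∂P, 0 ≤ κ ω}

/-- The set `C^x = K^x - L²₊(P)` of the wealths attainable from `x` after possibly throwing away
money (Minkowski difference of subsets of `L²(P)`). -/
def attainableWithDisposal (P : Measure Ω) (ε : ℕ → Ω → ℝ) (b : ℕ → ℝ) (x : ℝ) :
    Set (Lp ℝ 2 P) :=
  attainable P ε b x - nonnegL2 P

/-- A subset of `L²(P)` is closed in probability if it contains each element of `L²(P)` that is the
limit in probability of a sequence of its elements. (Convergence in probability is metrizable, so
sequences suffice.) -/
def ClosedInProbability (P : Measure Ω) (C : Set (Lp ℝ 2 P)) : Prop :=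
  ∀ (X : ℕ → Lp ℝ 2 P) (Y : Lp ℝ 2 P), (∀ n, X n ∈ C) →
    TendstoInMeasure P (fun n => (X n : Ω → ℝ)) atTop (Y : Ω → ℝ) → Y ∈ C

end LargeMarket

/-! Membership in $C^z$ means $\theta - z \le G(h)$ almost surely, where $G(h) = \sum_i
h_i(\varepsilon_i - b_i)$ is a bounded linear map $\ell_2 \to L^2(P)$ (`gains`). Given $\theta_n - z
\le G(h_n)$ with $\theta_n \to \theta$ almost surely along a subsequence, it suffices that $(h_n)$
has a bounded subsequence: a weak limit $g$ then satisfies $\theta - z \le G(g)$, since bounded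
linear maps preserve weak convergence and almost sure lower bounds survive it
(`ae_le_of_weak_limit`).

Suppose instead $\|h_n\| \to \infty$ and put $g_n = h_n/\|h_n\|$. The gains $G(g_n)$ have lower
bounds tending to $0$, so a weak limit $a$ of $g_n$ has $G(a) \ge 0$, and absence of arbitrage gives
$a = 0$ (`eq_zero_of_nonneg`). Hence $E\,G(g_n) = -\langle b, g_n\rangle \to 0$. The negative parts
of $G(g_n)$ vanish in $L^1$ by uniform integrability, so $E|G(g_n)| \to 0$. Bounded third moments
make the $L^1$ and $L^2$ norms equivalent on sums $\sum_i h_i\varepsilon_i$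
(`sqrt_sum_sq_le_integral_abs`), which forces $\|g_n\| \to 0$, contradicting $\|g_n\| = 1$. -/

namespace LargeMarket

/-! ### Weak limits and almost sure lower bounds in $L^2$ -/

/-- A bounded sequence of a real Hilbert space converges weakly along every ultrafilter. -/
theorem exists_weak_limit {E : Type*} [NormedAddCommGroup E] [InnerProductSpace ℝ E]
    [CompleteSpace E] {ι : Type*} (U : Ultrafilter ι) (x : ι → E) {R : ℝ} (hx : ∀ n, ‖x n‖ ≤ R) :
    ∃ a : E, ∀ y, Tendsto (fun n => inner ℝ (x n) y) U (𝓝 (inner ℝ a y)) := by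
  let f : ι → WeakDual ℝ E := fun n =>
    StrongDual.toWeakDual (InnerProductSpace.toDual ℝ E (x n))
  have hK := WeakDual.isCompact_closedBall (𝕜 := ℝ) (E := E) 0 R
  have hmem : ∀ n, f n ∈ WeakDual.toStrongDual ⁻¹' Metric.closedBall (0 : StrongDual ℝ E) R := by
    intro n
    simp only [Set.mem_preimage, mem_closedBall_zero_iff]
    exact ((InnerProductSpace.toDual ℝ E).norm_map (x n)).trans_le (hx n)
  obtain ⟨g, -, hg⟩ := hK.ultrafilter_le_nhds (U.map f)
    (le_principal_iff.2 (Filter.mem_map.2 (Eventually.of_forall hmem)))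
  refine ⟨(InnerProductSpace.toDual ℝ E).symm (WeakDual.toStrongDual g), fun y => ?_⟩
  have h1 : Tendsto f U (𝓝 g) := hg
  have h2 := ((WeakDual.eval_continuous y).tendsto g).comp h1
  simpa [f, Function.comp_def] using! h2

section

variable {Ω : Type*} [MeasurableSpace Ω] {P : Measure Ω}

theorem integral_sq_eq_norm_sq (w : Lp ℝ 2 P) : ∫ ω, w ω ^ 2 ∂P = ‖w‖ ^ 2 := by
  rw [← real_inner_self_eq_norm_sq, L2.inner_def]
  simp [sq]

theorem integrable_sq_coeFn (w : Lp ℝ 2 P) : Integrable (fun ω => w ω ^ 2) P :=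
  (Lp.memLp w).integrable_sq

variable [IsProbabilityMeasure P]

/-- Almost sure lower bounds that converge almost surely pass to weak limits in `L²`. -/
theorem ae_le_of_weak_limit {l : Filter ℕ} [l.NeBot] (hl : l ≤ atTop)
    {θ u : ℕ → Lp ℝ 2 P} {η v : Lp ℝ 2 P}
    (hle : ∀ n, ∀ᵐ ω ∂P, θ n ω ≤ u n ω)
    (hθ : ∀ᵐ ω ∂P, Tendsto (fun n => θ n ω) atTop (𝓝 (η ω)))
    (hu : ∀ y, Tendsto (fun n => inner ℝ (u n) y) l (𝓝 (inner ℝ v y))) :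
    ∀ᵐ ω ∂P, η ω ≤ v ω := by
  have hm : ∀ w : Lp ℝ 2 P, Measurable (w : Ω → ℝ) := fun w => (Lp.stronglyMeasurable w).measurable
  have hint : ∀ w : Lp ℝ 2 P, Integrable (w : Ω → ℝ) P := fun w =>
    (Lp.memLp w).integrable (by norm_num)
  have key : ∀ (N k : ℕ), ∀ᵐ ω ∂P, (∀ n ≥ N, η ω - 1 / ((k : ℝ) + 1) ≤ θ n ω) →
      η ω - 1 / ((k : ℝ) + 1) ≤ v ω := by
    intro N k
    set δ : ℝ := 1 / ((k : ℝ) + 1)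
    -- Testing weak convergence against the indicator of this set, where the conclusion fails, shows
    -- that it is null. The convergence rank of `θ n ω` depends on `ω`, so `N` and `k` range over
    -- countable families.
    set B : Set Ω := {ω | (∀ n ≥ N, η ω - δ ≤ θ n ω) ∧ v ω < η ω - δ}
    have hB : MeasurableSet B := by
      refine MeasurableSet.inter ?_ (measurableSet_lt (hm v) ((hm η).sub_const δ))
      have : {ω | ∀ n ≥ N, η ω - δ ≤ θ n ω} = ⋂ n, ⋂ (_ : n ≥ N), {ω | η ω - δ ≤ θ n ω} := by
        ext; simp
      change MeasurableSet {ω | ∀ n ≥ N, η ω - δ ≤ θ n ω}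
      rw [this]
      exact MeasurableSet.iInter fun n => MeasurableSet.iInter fun _ =>
        measurableSet_le ((hm η).sub_const δ) (hm (θ n))
    have hinner : ∀ w : Lp ℝ 2 P,
        inner ℝ w (indicatorConstLp 2 hB (measure_ne_top P B) (1 : ℝ)) = ∫ ω in B, w ω ∂P := by
      intro w
      rw [real_inner_comm, L2.inner_indicatorConstLp_one]
    have hlim := hu (indicatorConstLp 2 hB (measure_ne_top P B) (1 : ℝ))
    simp only [hinner] at hlim
    have hint' : Integrable (fun ω => η ω - δ) P := (hint η).sub (integrable_const δ)
    have hge : ∫ ω in B, (η ω - δ) ∂P ≤ ∫ ω in B, v ω ∂P := by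
      refine ge_of_tendsto hlim ?_
      filter_upwards [hl (eventually_ge_atTop N)] with n hn
      refine setIntegral_mono_on_ae hint'.integrableOn (hint (u n)).integrableOn hB ?_
      filter_upwards [hle n] with ω hω hωB
      exact (hωB.1 n hn).trans hω
    have h0 : P B = 0 := by
      by_contra hne
      have hpos : 0 < ∫ ω in B, ((η ω - δ) - v ω) ∂P := by
        rw [setIntegral_pos_iff_support_of_nonneg_ae]
        · refine lt_of_lt_of_le (pos_iff_ne_zero.2 hne) (measure_mono fun ω hω => ⟨?_, hω⟩)
          exact (sub_pos.2 hω.2).ne'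
        · filter_upwards [ae_restrict_mem hB] with ω hω
          exact (sub_pos.2 hω.2).le
        · exact (hint'.sub (hint v)).integrableOn
      rw [integral_sub hint'.integrableOn (hint v).integrableOn] at hpos
      linarith
    have h0' : ∀ᵐ ω ∂P, ω ∉ B := measure_eq_zero_iff_ae_notMem.1 h0
    filter_upwards [h0'] with ω hω hN
    by_contra hlt
    exact hω ⟨hN, not_le.1 hlt⟩
  filter_upwards [ae_all_iff.2 fun N => ae_all_iff.2 (key N), hθ] with ω hω hlim
  have hk : ∀ k : ℕ, η ω - 1 / ((k : ℝ) + 1) ≤ v ω := by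
    intro k
    have hlt : η ω - 1 / ((k : ℝ) + 1) < η ω := sub_lt_self _ Nat.one_div_pos_of_nat
    obtain ⟨N, hN⟩ := eventually_atTop.1 (hlim.eventually_const_le hlt)
    exact hω N k hN
  have := (tendsto_one_div_add_atTop_nhds_zero_nat (𝕜 := ℝ)).const_sub (η ω)
  rw [sub_zero] at this
  exact le_of_tendsto this (Eventually.of_forall hk)

/-- The negative parts of an `L²`-bounded sequence vanish in `L¹` if they are dominated by a
sequence that vanishes almost surely. -/
theorem tendsto_integral_negPart {u r : ℕ → Lp ℝ 2 P} {R : ℝ} (hR : ∀ n, ‖u n‖ ≤ R)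
    (hle : ∀ n, ∀ᵐ ω ∂P, r n ω ≤ u n ω)
    (hr : ∀ᵐ ω ∂P, Tendsto (fun n => r n ω) atTop (𝓝 0)) :
    Tendsto (fun n => ∫ ω, max (-u n ω) 0 ∂P) atTop (𝓝 0) := by
  have hm : ∀ w : Lp ℝ 2 P, Measurable (w : Ω → ℝ) := fun w => (Lp.stronglyMeasurable w).measurable
  have hR0 : 0 ≤ R := (norm_nonneg _).trans (hR 0)
  have hmin : ∀ K : ℝ, 0 < K → Tendsto (fun n => ∫ ω, min |r n ω| K ∂P) atTop (𝓝 0) := by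
    intro K hK
    have := tendsto_integral_of_dominated_convergence (μ := P) (F := fun n ω => min |r n ω| K)
      (f := fun _ => 0) (fun _ => K)
      (fun n => (((hm (r n)).abs).min measurable_const).aestronglyMeasurable)
      (integrable_const K)
      (fun n => Eventually.of_forall fun ω => by
        rw [Real.norm_eq_abs, abs_of_nonneg (le_min (abs_nonneg _) hK.le)]
        exact min_le_right _ _)
      (by
        filter_upwards [hr] with ω hω
        have := (hω.abs.min (tendsto_const_nhds (x := K)))
        simpa [hK.le] using this)
    simpa using this
  have hbound : ∀ K : ℝ, 0 < K → ∀ n,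
      ∫ ω, max (-u n ω) 0 ∂P ≤ ∫ ω, min |r n ω| K ∂P + R ^ 2 / K := by
    intro K hK n
    have hi1 : Integrable (fun ω => min |r n ω| K) P := by
      refine Integrable.mono' (integrable_const K)
        (((hm (r n)).abs).min measurable_const).aestronglyMeasurable
        (Eventually.of_forall fun ω => ?_)
      rw [Real.norm_eq_abs, abs_of_nonneg (le_min (abs_nonneg _) hK.le)]
      exact min_le_right _ _
    have hi2 : Integrable (fun ω => u n ω ^ 2 / K) P := (integrable_sq_coeFn (u n)).div_const K
    have hsq : ∫ ω, u n ω ^ 2 / K ∂P ≤ R ^ 2 / K := by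
      rw [integral_div, integral_sq_eq_norm_sq]
      gcongr
      exact hR n
    calc ∫ ω, max (-u n ω) 0 ∂P ≤ ∫ ω, (min |r n ω| K + u n ω ^ 2 / K) ∂P := by
          refine integral_mono_ae (((Lp.memLp (u n)).integrable (by norm_num)).neg.pos_part)
            (hi1.add hi2) ?_
          filter_upwards [hle n] with ω hω
          have hsqn : 0 ≤ u n ω ^ 2 / K := by positivity
          have hminn : 0 ≤ min |r n ω| K := le_min (abs_nonneg _) hK.le
          refine max_le ?_ (by positivity)
          -- If $|r| \le K$ then $-u \le -r \le |r|$. Otherwise $-u \le K + u^2/K$ holds for every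
          -- $u$.
          rcases le_total |r n ω| K with h | h
          · rw [min_eq_left h]
            linarith [neg_abs_le (r n ω)]
          · rw [min_eq_right h]
            have : -u n ω * K ≤ K * K + u n ω ^ 2 := by nlinarith [sq_nonneg (u n ω + K)]
            rw [← sub_nonneg]
            have h2 : K + u n ω ^ 2 / K - -u n ω = (K * K + u n ω ^ 2 - -u n ω * K) / K := by
              field_simp
            rw [h2]
            exact div_nonneg (by linarith) hK.le
      _ ≤ _ := by
          rw [integral_add hi1 hi2]
          linarith
  refine tendsto_order.2 ⟨fun a ha => Eventually.of_forall fun n =>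
    ha.trans_le (integral_nonneg fun ω => le_max_right _ _), fun a ha => ?_⟩
  -- This truncation level makes $R^2/K < a/2$; the $+1$ keeps it positive when $R = 0$.
  have hK : 0 < 2 * (R ^ 2 + 1) / a := by positivity
  filter_upwards [(hmin _ hK).eventually_lt_const (half_pos ha)] with n hn
  have h1 := hbound _ hK n
  have h2 : R ^ 2 / (2 * (R ^ 2 + 1) / a) < a / 2 := by
    rw [div_lt_iff₀ hK]
    have : a / 2 * (2 * (R ^ 2 + 1) / a) = R ^ 2 + 1 := by field_simp
    linarith
  linarith

/-- Second-order Taylor expansion of $|\cdot|^3$ at $x$; the second derivative $6|\cdot|$ is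
$6$-Lipschitz, so the remainder is at most $|y|^3$. Keeping the linear term signed lets it integrate
to zero for independent centred $y$. -/
theorem abs_add_pow_three_le (x y : ℝ) :
    |x + y| ^ 3 ≤ |x| ^ 3 + 3 * (x * |x|) * y + 3 * (|x| * y ^ 2) + |y| ^ 3 := by
  rcases abs_cases x with ⟨h1, h1'⟩ | ⟨h1, h1'⟩ <;> rcases abs_cases y with ⟨h2, h2'⟩ | ⟨h2, h2'⟩ <;>
    rcases abs_cases (x + y) with ⟨h3, h3'⟩ | ⟨h3, h3'⟩ <;> rw [h1, h2, h3]
  · nlinarith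
  · linarith
  · nlinarith [pow_nonneg (neg_nonneg.2 h2'.le) 3]
  -- The difference of the two sides is $2x(x^2 + 3xy + 3y^2) = 2x\bigl((x + \tfrac32 y)^2 +
  -- \tfrac34 y^2\bigr)$.
  · nlinarith [mul_nonneg h1' (sq_nonneg (x + 3 / 2 * y)), mul_nonneg h1' (sq_nonneg y)]
  · nlinarith [mul_nonneg (neg_nonneg.2 h1'.le) (sq_nonneg (x + 3 / 2 * y)),
      mul_nonneg (neg_nonneg.2 h1'.le) (sq_nonneg y)]
  · nlinarith [pow_nonneg h2' 3]
  · linarith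
  · nlinarith

end

/-! ### Third moments: comparison of the $L^1$ and $L^2$ norms of sums of sources -/

section

variable {Ω : Type*} [MeasurableSpace Ω] {P : Measure Ω}
  {ε : ℕ → Ω → ℝ} {b : ℕ → ℝ}

theorem BoundedThirdMoments.exists_bound (h3 : BoundedThirdMoments P ε)
    (hε : StandardizedSources P ε) :
    ∃ M : ℝ, 0 ≤ M ∧ ∀ i, MemLp (ε i) 3 P ∧ ∫ ω, |ε i ω| ^ 3 ∂P ≤ M := by
  refine ⟨(⨆ i, ∫⁻ ω, ‖ε i ω‖ₑ ^ 3 ∂P).toReal, ENNReal.toReal_nonneg, fun i => ?_⟩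
  have hle : ∫⁻ ω, ‖ε i ω‖ₑ ^ 3 ∂P ≤ ⨆ i, ∫⁻ ω, ‖ε i ω‖ₑ ^ 3 ∂P :=
    le_iSup (fun i => ∫⁻ ω, ‖ε i ω‖ₑ ^ 3 ∂P) i
  have hlt : ∫⁻ ω, ‖ε i ω‖ₑ ^ 3 ∂P < ∞ := hle.trans_lt h3
  have hmem : MemLp (ε i) 3 P := by
    refine ⟨(hε.measurable i).aestronglyMeasurable, ?_⟩
    rw [eLpNorm_lt_top_iff_lintegral_rpow_enorm_lt_top (by norm_num) (by norm_num)]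
    simpa using! hlt
  refine ⟨hmem, ?_⟩
  have : ∫ ω, |ε i ω| ^ 3 ∂P = (∫⁻ ω, ‖ε i ω‖ₑ ^ 3 ∂P).toReal := by
    rw [integral_eq_lintegral_of_nonneg_ae (Eventually.of_forall fun ω => by positivity)
      ((hε.measurable i).abs.pow_const 3).aestronglyMeasurable]
    congr 1
    refine lintegral_congr fun ω => ?_
    rw [ENNReal.ofReal_pow (abs_nonneg _), ← Real.norm_eq_abs, ofReal_norm]
  rw [this]
  exact ENNReal.toReal_mono h3.ne hle

theorem integrable_abs_pow_three {X : Ω → ℝ} (hX : MemLp X 3 P) :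
    Integrable (fun ω => |X ω| ^ 3) P := by
  simpa using hX.integrable_norm_pow (p := 3) (by norm_num)

theorem StandardizedSources.integral_mul (hε : StandardizedSources P ε) {i j : ℕ} (hij : i ≠ j) :
    ∫ ω, ε i ω * ε j ω ∂P = 0 := by
  rw [(hε.indep.indepFun hij).integral_fun_mul_eq_mul_integral
    (hε.measurable i).aestronglyMeasurable (hε.measurable j).aestronglyMeasurable,
    hε.mean_zero, zero_mul]

theorem StandardizedSources.indepFun_sum (hε : StandardizedSources P ε) (h : ℕ → ℝ) (n : ℕ) :
    IndepFun (fun ω => ∑ i ∈ Finset.range n, h i * ε i ω) (fun ω => h n * ε n ω) P := by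
  have h1 : iIndepFun (fun i ω => h i * ε i ω) P :=
    hε.indep.comp (fun i x => h i * x) fun i => measurable_id.const_mul (h i)
  have h2 := h1.indepFun_finsetSum_of_notMem (fun i => (hε.measurable i).const_mul (h i))
    (Finset.notMem_range_self (n := n))
  convert h2 using 1
  ext ω
  simp

theorem memLp_sum {p : ℝ≥0∞}
    (hp : ∀ i, MemLp (ε i) p P) (h : ℕ → ℝ) (n : ℕ) :
    MemLp (fun ω => ∑ i ∈ Finset.range n, h i * ε i ω) p P :=
  memLp_finsetSum _ fun i _ => (hp i).const_mul (h i)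

variable [IsProbabilityMeasure P]

/-- Growth of the absolute third moment when an independent centred summand is added. -/
theorem integral_abs_add_pow_three_le {X Y : Ω → ℝ} (hX : MemLp X 3 P) (hY : MemLp Y 3 P)
    (hXY : IndepFun X Y P) (hY0 : ∫ ω, Y ω ∂P = 0) :
    ∫ ω, |X ω + Y ω| ^ 3 ∂P ≤
      ∫ ω, |X ω| ^ 3 ∂P + 3 * ((∫ ω, |X ω| ∂P) * ∫ ω, Y ω ^ 2 ∂P) + ∫ ω, |Y ω| ^ 3 ∂P := by
  have hX2 : MemLp X 2 P := hX.mono_exponent (by norm_num)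
  have hY2 : MemLp Y 2 P := hY.mono_exponent (by norm_num)
  have hX1 : Integrable X P := hX2.integrable (by norm_num)
  have hY1 : Integrable Y P := hY2.integrable (by norm_num)
  have hXX : Integrable (fun ω => X ω * |X ω|) P := by
    refine (hX2.integrable_sq).mono' (hX1.1.mul hX1.abs.1) (Eventually.of_forall fun ω => ?_)
    rw [norm_mul, Real.norm_eq_abs, Real.norm_eq_abs, abs_abs, ← sq, sq_abs]
  have hind1 : IndepFun (fun ω => X ω * |X ω|) Y P :=
    hXY.comp (φ := fun x => x * |x|) (ψ := id) (measurable_id.mul measurable_id.abs) measurable_id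
  have hind2 : IndepFun (fun ω => |X ω|) (fun ω => Y ω ^ 2) P :=
    hXY.comp (φ := fun x => |x|) (ψ := fun y => y ^ 2) measurable_id.abs
      (measurable_id.pow_const 2)
  have hi1 : Integrable (fun ω => X ω * |X ω| * Y ω) P := hind1.integrable_mul hXX hY1
  have hi2 : Integrable (fun ω => |X ω| * Y ω ^ 2) P :=
    hind2.integrable_mul hX1.abs hY2.integrable_sq
  have he1 : ∫ ω, X ω * |X ω| * Y ω ∂P = 0 := by
    rw [hind1.integral_fun_mul_eq_mul_integral hXX.1 hY1.1, hY0, mul_zero]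
  have he2 : ∫ ω, |X ω| * Y ω ^ 2 ∂P = (∫ ω, |X ω| ∂P) * ∫ ω, Y ω ^ 2 ∂P :=
    hind2.integral_fun_mul_eq_mul_integral hX1.abs.1 hY2.integrable_sq.1
  have hX3 := integrable_abs_pow_three hX
  have hY3 := integrable_abs_pow_three hY
  have hsum2 : Integrable (fun ω => |X ω| ^ 3 + 3 * (X ω * |X ω| * Y ω)) P :=
    hX3.add (hi1.const_mul 3)
  have hsum3 : Integrable
      (fun ω => |X ω| ^ 3 + 3 * (X ω * |X ω| * Y ω) + 3 * (|X ω| * Y ω ^ 2)) P :=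
    hsum2.add (hi2.const_mul 3)
  calc ∫ ω, |X ω + Y ω| ^ 3 ∂P
      ≤ ∫ ω, (|X ω| ^ 3 + 3 * (X ω * |X ω| * Y ω) + 3 * (|X ω| * Y ω ^ 2) + |Y ω| ^ 3) ∂P := by
        refine integral_mono (integrable_abs_pow_three (hX.add hY))
          (hsum3.add hY3) fun ω => ?_
        have := abs_add_pow_three_le (X ω) (Y ω)
        simp only
        linarith
    _ = _ := by
        rw [integral_add hsum3 hY3, integral_add hsum2 (hi2.const_mul 3),
          integral_add hX3 (hi1.const_mul 3), integral_const_mul, integral_const_mul, he1, he2]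
        ring

theorem integral_abs_le_of_integral_sq_le {X : Ω → ℝ} (hX : MemLp X 2 P) {s : ℝ} (hs : 0 ≤ s)
    (h : ∫ ω, X ω ^ 2 ∂P ≤ s ^ 2) : ∫ ω, |X ω| ∂P ≤ s := by
  have h1 : (∫ ω, |X ω| ∂P) ^ 2 ≤ ∫ ω, |X ω| ^ 2 ∂P := by
    have := variance_nonneg |X| P
    rw [variance_eq_sub hX.abs] at this
    simpa using! this
  simp only [sq_abs] at h1
  exact abs_le_of_sq_le_sq' (h1.trans h) hs |>.2

theorem StandardizedSources.integral_sum_sq (hε : StandardizedSources P ε) (h : ℕ → ℝ) (n : ℕ) :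
    ∫ ω, (∑ i ∈ Finset.range n, h i * ε i ω) ^ 2 ∂P = ∑ i ∈ Finset.range n, h i ^ 2 := by
  induction n with
  | zero => simp
  | succ n ih =>
    have hS := memLp_sum hε.square_integrable h n
    have hY : MemLp (fun ω => h n * ε n ω) 2 P := (hε.square_integrable n).const_mul (h n)
    have hind := hε.indepFun_sum h n
    have hY0 : ∫ ω, h n * ε n ω ∂P = 0 := by rw [integral_const_mul, hε.mean_zero, mul_zero]
    have hmul : ∫ ω, (∑ i ∈ Finset.range n, h i * ε i ω) * (h n * ε n ω) ∂P = 0 := by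
      rw [hind.integral_fun_mul_eq_mul_integral hS.1 hY.1, hY0, mul_zero]
    have hi : Integrable (fun ω => (∑ i ∈ Finset.range n, h i * ε i ω) * (h n * ε n ω)) P :=
      hind.integrable_mul (hS.integrable (by norm_num)) (hY.integrable (by norm_num))
    have hexp : ∀ ω, (∑ i ∈ Finset.range (n + 1), h i * ε i ω) ^ 2 =
        (∑ i ∈ Finset.range n, h i * ε i ω) ^ 2 +
          2 * ((∑ i ∈ Finset.range n, h i * ε i ω) * (h n * ε n ω)) + h n ^ 2 * ε n ω ^ 2 := by
      intro ω
      rw [Finset.sum_range_succ]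
      ring
    simp only [hexp]
    have hi2 : Integrable (fun ω => (∑ i ∈ Finset.range n, h i * ε i ω) ^ 2 +
        2 * ((∑ i ∈ Finset.range n, h i * ε i ω) * (h n * ε n ω))) P :=
      hS.integrable_sq.add (hi.const_mul 2)
    rw [integral_add hi2 ((hε.square_integrable n).integrable_sq.const_mul _),
      integral_add hS.integrable_sq (hi.const_mul 2), integral_const_mul, integral_const_mul,
      hmul, ih, hε.second_moment, Finset.sum_range_succ]
    ring

/-- A Rosenthal-type inequality for the third moment of a sum of independent sources. -/
theorem StandardizedSources.integral_abs_sum_pow_three_le (hε : StandardizedSources P ε) {M : ℝ}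
    (hM : ∀ i, MemLp (ε i) 3 P ∧ ∫ ω, |ε i ω| ^ 3 ∂P ≤ M) (h : ℕ → ℝ) {s : ℝ}
    (hs : 0 ≤ s) (n : ℕ) (hn : ∑ i ∈ Finset.range n, h i ^ 2 ≤ s ^ 2) :
    ∫ ω, |∑ i ∈ Finset.range n, h i * ε i ω| ^ 3 ∂P ≤
      (3 + M) * s * ∑ i ∈ Finset.range n, h i ^ 2 := by
  -- The bound `s` stays fixed during the induction: it dominates both $E|S_n|$ and $|h_n|$, so the
  -- new summand contributes at most $(3 + M)\,s\,h_n^2$.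
  induction n with
  | zero => simp
  | succ n ih =>
    rw [Finset.sum_range_succ] at hn
    have hsum0 : 0 ≤ ∑ i ∈ Finset.range n, h i ^ 2 := Finset.sum_nonneg fun i _ => sq_nonneg _
    have hn' : ∑ i ∈ Finset.range n, h i ^ 2 ≤ s ^ 2 := by linarith [sq_nonneg (h n)]
    have hhn : |h n| ≤ s := abs_le_of_sq_le_sq (by linarith) hs
    have hY : MemLp (fun ω => h n * ε n ω) 3 P := (hM n).1.const_mul (h n)
    have hY0 : ∫ ω, h n * ε n ω ∂P = 0 := by rw [integral_const_mul, hε.mean_zero, mul_zero]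
    have hstep := integral_abs_add_pow_three_le (memLp_sum (fun i => (hM i).1) h n) hY
      (hε.indepFun_sum h n) hY0
    have habs : ∫ ω, |∑ i ∈ Finset.range n, h i * ε i ω| ∂P ≤ s :=
      integral_abs_le_of_integral_sq_le (memLp_sum hε.square_integrable h n) hs
        ((hε.integral_sum_sq h n).trans_le hn')
    have hY2 : ∫ ω, (h n * ε n ω) ^ 2 ∂P = h n ^ 2 := by
      simp only [mul_pow]
      rw [integral_const_mul, hε.second_moment, mul_one]
    have hY3 : ∫ ω, |h n * ε n ω| ^ 3 ∂P ≤ M * s * h n ^ 2 := by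
      simp only [abs_mul, mul_pow]
      rw [integral_const_mul]
      have hM0 : 0 ≤ ∫ ω, |ε n ω| ^ 3 ∂P := integral_nonneg fun ω => by positivity
      calc |h n| ^ 3 * ∫ ω, |ε n ω| ^ 3 ∂P = |h n| * h n ^ 2 * ∫ ω, |ε n ω| ^ 3 ∂P := by
            rw [← sq_abs (h n)]; ring
        _ ≤ s * h n ^ 2 * M := by
            gcongr
            exact (hM n).2
        _ = M * s * h n ^ 2 := by ring
    simp only [Finset.sum_range_succ]
    rw [hY2] at hstep
    have := mul_le_mul_of_nonneg_right habs (sq_nonneg (h n))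
    linarith [ih hn']

/-- The `L²` norm of a sum of independent sources is controlled by its `L¹` norm. -/
theorem StandardizedSources.sqrt_sum_sq_le_integral_abs (hε : StandardizedSources P ε) {M : ℝ}
    (hM0 : 0 ≤ M) (hM : ∀ i, MemLp (ε i) 3 P ∧ ∫ ω, |ε i ω| ^ 3 ∂P ≤ M) (h : ℕ → ℝ) (n : ℕ) :
    √(∑ i ∈ Finset.range n, h i ^ 2) ≤
      (3 + M) * ∫ ω, |∑ i ∈ Finset.range n, h i * ε i ω| ∂P := by
  have hsum0 : 0 ≤ ∑ i ∈ Finset.range n, h i ^ 2 := Finset.sum_nonneg fun i _ => sq_nonneg _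
  obtain ⟨s, hsdef⟩ : ∃ s, s = √(∑ i ∈ Finset.range n, h i ^ 2) := ⟨_, rfl⟩
  have hs0 : 0 ≤ s := hsdef ▸ Real.sqrt_nonneg _
  have hs2 : s ^ 2 = ∑ i ∈ Finset.range n, h i ^ 2 := by
    rw [hsdef, Real.sq_sqrt hsum0]
  rw [← hsdef]
  have hint0 : 0 ≤ ∫ ω, |∑ i ∈ Finset.range n, h i * ε i ω| ∂P :=
    integral_nonneg fun ω => abs_nonneg _
  rcases hs0.eq_or_lt with h0 | hs
  · rw [← h0]
    positivity
  have h3 := hε.integral_abs_sum_pow_three_le hM h hs.le n hs2.ge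
  have h2 := hε.integral_sum_sq h n
  rw [← hs2] at h2 h3
  have hS1 : Integrable (fun ω => |∑ i ∈ Finset.range n, h i * ε i ω|) P :=
    ((memLp_sum hε.square_integrable h n).integrable (by norm_num)).abs
  have hS3 := integrable_abs_pow_three (memLp_sum (fun i => (hM i).1) h n)
  -- With this `t` the third-moment bound reads $E|S|^3 \le t s^2$. Integrating $|S|(|S| - t)^2 \ge
  -- 0$ gives $2ts^2 \le t^2 E|S| + E|S|^3$, and the last term is absorbed on the left.
  set t := (3 + M) * s
  have ht : 0 < t := by positivity
  have hle : ∫ ω, 2 * t * (∑ i ∈ Finset.range n, h i * ε i ω) ^ 2 ∂P ≤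
      ∫ ω, (t ^ 2 * |∑ i ∈ Finset.range n, h i * ε i ω| +
        |∑ i ∈ Finset.range n, h i * ε i ω| ^ 3) ∂P := by
    refine integral_mono ((memLp_sum hε.square_integrable h n).integrable_sq.const_mul _)
      ((hS1.const_mul _).add hS3) fun ω => ?_
    simp only
    rw [← sq_abs]
    nlinarith [mul_nonneg (abs_nonneg (∑ i ∈ Finset.range n, h i * ε i ω))
      (sq_nonneg (|∑ i ∈ Finset.range n, h i * ε i ω| - t))]
  rw [integral_const_mul, h2, integral_add (hS1.const_mul _) hS3, integral_const_mul] at hle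
  have h4 : t * s ^ 2 ≤ t ^ 2 * ∫ ω, |∑ i ∈ Finset.range n, h i * ε i ω| ∂P := by
    change _ ≤ t * s ^ 2 at h3
    linarith
  have h5 : t * s * s ≤ t * s * ((3 + M) * ∫ ω, |∑ i ∈ Finset.range n, h i * ε i ω| ∂P) := by
    calc t * s * s = t * s ^ 2 := by ring
      _ ≤ _ := h4
      _ = _ := by simp only [t]; ring
  exact le_of_mul_le_mul_left h5 (by positivity)

/-! ### Absence of arbitrage with infinitely many sources -/

/-- Finitely many sources can be jointly unfavourable, one of them by a definite amount. -/
theorem StandardizedSources.exists_sum_lt_neg (hε : StandardizedSources P ε)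
    (hna : NoSourceArbitrage P ε b) (h : ℕ → ℝ) {i₀ : ℕ} (hi₀ : h i₀ ≠ 0) :
    ∃ c > 0, ∀ n > i₀, 0 < P {ω | ∑ i ∈ Finset.range n, h i * (ε i ω - b i) < -c} := by
  have hpos : ∀ i, h i ≠ 0 → 0 < P {ω | h i * (ε i ω - b i) < 0} := by
    intro i hi
    rcases lt_or_gt_of_ne hi with hlt | hgt
    · refine (hna i).1.trans_le (measure_mono fun ω hω => ?_)
      exact mul_neg_of_neg_of_pos hlt (sub_pos.2 hω)
    · refine (hna i).2.trans_le (measure_mono fun ω hω => ?_)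
      exact mul_neg_of_pos_of_neg hgt (sub_neg.2 hω)
  obtain ⟨k, hk⟩ : ∃ k : ℕ, 0 < P {ω | h i₀ * (ε i₀ ω - b i₀) < -(1 / ((k : ℝ) + 1))} := by
    by_contra! hcon
    refine (hpos i₀ hi₀).ne' (measure_mono_null (fun ω hω => ?_)
      (measure_iUnion_null fun k => le_zero_iff.1 (hcon k)))
    obtain ⟨k, hk⟩ := exists_nat_one_div_lt (neg_pos.2 (show h i₀ * (ε i₀ ω - b i₀) < 0 from hω))
    exact Set.mem_iUnion.2 ⟨k, by simp only [Set.mem_ofPred_eq]; linarith⟩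
  refine ⟨1 / ((k : ℝ) + 1), Nat.one_div_pos_of_nat, fun n hn => ?_⟩
  set c : ℝ := 1 / ((k : ℝ) + 1)
  -- Only source `i₀` must lose strictly, so `c` does not depend on `n`. The weak inequality for the
  -- others makes `B i` the whole line when `h i = 0`.
  let B : ℕ → Set ℝ := fun i => {x | h i * (x - b i) ≤ 0 ∧ (i = i₀ → h i * (x - b i) < -c)}
  have hBm : ∀ i, MeasurableSet (B i) := by
    intro i
    have hm : Measurable fun x : ℝ => h i * (x - b i) :=
      (measurable_id.sub_const (b i)).const_mul (h i)
    exact (measurableSet_le hm measurable_const).inter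
      ((MeasurableSet.const (i = i₀)).imp (measurableSet_lt hm measurable_const))
  have hc : 0 < c := Nat.one_div_pos_of_nat
  have hBpos : ∀ i, 0 < P (ε i ⁻¹' B i) := by
    intro i
    by_cases hi : i = i₀
    · subst hi
      refine hk.trans_le (measure_mono fun ω (hω : _ < _) => ⟨?_, fun _ => hω⟩)
      linarith
    · by_cases h0 : h i = 0
      · have : ε i ⁻¹' B i = Set.univ := by
          ext ω
          simp [B, h0, hi]
        rw [this, measure_univ]
        exact one_pos
      · exact (hpos i h0).trans_le (measure_mono fun ω (hω : _ < _) =>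
          ⟨hω.le, fun h => absurd h hi⟩)
  have hprod := hε.indep.measure_inter_preimage_eq_mul (Finset.range n) (sets := B)
    fun i _ => hBm i
  have hprodpos : 0 < P (⋂ i ∈ Finset.range n, ε i ⁻¹' B i) := by
    rw [hprod]
    exact pos_iff_ne_zero.2 (Finset.prod_ne_zero_iff.2 fun i _ => (hBpos i).ne')
  refine hprodpos.trans_le (measure_mono fun ω hω => ?_)
  simp only [Set.mem_iInter] at hω
  have hmem : i₀ ∈ Finset.range n := Finset.mem_range.2 hn
  change ∑ i ∈ Finset.range n, h i * (ε i ω - b i) < -c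
  rw [← Finset.add_sum_erase _ _ hmem]
  have h1 := (hω i₀ hmem).2 rfl
  have h2 : ∑ i ∈ (Finset.range n).erase i₀, h i * (ε i ω - b i) ≤ 0 :=
    Finset.sum_nonpos fun i hi => (hω i (Finset.mem_of_mem_erase hi)).1
  linarith

/-- A portfolio whose partial sums converge in probability to an almost surely nonnegative limit
is trivial. -/
theorem StandardizedSources.eq_zero_of_nonneg (hε : StandardizedSources P ε)
    (hna : NoSourceArbitrage P ε b) (h : ℕ → ℝ) {X : Ω → ℝ}
    (hX : TendstoInMeasure P (fun n ω => ∑ i ∈ Finset.range n, h i * (ε i ω - b i)) atTop X)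
    (h0 : ∀ᵐ ω ∂P, 0 ≤ X ω) (i : ℕ) : h i = 0 := by
  by_contra hi
  obtain ⟨c, hc, hpos⟩ := hε.exists_sum_lt_neg hna h hi
  set S : ℕ → Ω → ℝ := fun n ω => ∑ i ∈ Finset.range n, h i * (ε i ω - b i) with hS
  have hSm : ∀ n, Measurable (S n) := fun n => Finset.measurable_fun_sum _ fun i _ =>
    ((hε.measurable i).sub_const (b i)).const_mul (h i)
  rw [tendstoInMeasure_iff_dist] at hX
  have hX4 := hX (c / 4) (by positivity)
  -- For $m \ge N$, both $S_m$ and $S_N$ lie within $c/4$ of $X$ outside an event of probability at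
  -- most $1/2$. Then $S_m - S_N < c/2$, and this increment is independent of $S_N$, so the loss
  -- $S_N < -c$ cannot be recouped with certainty.
  obtain ⟨N, hN⟩ := eventually_atTop.1 ((hX4.eventually_lt_const
    (show (0 : ℝ≥0∞) < 1 / 4 by norm_num)).and (eventually_gt_atTop i))
  obtain ⟨hN4, hNi⟩ := hN N le_rfl
  have hp := hpos N hNi
  set p := P {ω | S N ω < -c}
  have hlow : ∀ m ≥ N, p * (1 / 2) ≤ P {ω | S m ω < -(c / 2)} := by
    intro m hm
    have hind : IndepFun (S N) (fun ω => S m ω - S N ω) P := by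
      have hdis : Disjoint (Finset.range N) (Finset.Ico N m) :=
        Finset.disjoint_left.2 fun j hj hj' =>
          absurd (Finset.mem_range.1 hj) (not_lt.2 (Finset.mem_Ico.1 hj').1)
      have := (hε.indep.indepFun_finset _ _ hdis hε.measurable).comp
        (φ := fun x => ∑ j : Finset.range N, h j * (x j - b j))
        (ψ := fun x => ∑ j : Finset.Ico N m, h j * (x j - b j))
        (by fun_prop) (by fun_prop)
      convert this using 1
      · ext ω
        simp only [hS, Function.comp_apply]
        exact (Finset.sum_coe_sort (Finset.range N) fun j => h j * (ε j ω - b j)).symm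
      · ext ω
        simp only [hS, Function.comp_apply]
        rw [← Finset.sum_Ico_eq_sub _ hm]
        exact (Finset.sum_coe_sort (Finset.Ico N m) fun j => h j * (ε j ω - b j)).symm
    have hprod := hind.measure_inter_preimage_eq_mul (Set.Iio (-c)) (Set.Iio (c / 2))
      measurableSet_Iio measurableSet_Iio
    have hhalf : 1 / 2 ≤ P ((fun ω => S m ω - S N ω) ⁻¹' Set.Iio (c / 2)) := by
      have hcompl : P ((fun ω => S m ω - S N ω) ⁻¹' Set.Iio (c / 2))ᶜ ≤ 1 / 2 := by
        calc P ((fun ω => S m ω - S N ω) ⁻¹' Set.Iio (c / 2))ᶜ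
            ≤ P ({ω | c / 4 ≤ dist (S m ω) (X ω)} ∪ {ω | c / 4 ≤ dist (S N ω) (X ω)}) := by
              refine measure_mono fun ω hω => ?_
              simp only [Set.mem_compl_iff, Set.mem_preimage, Set.mem_Iio, not_lt] at hω
              by_contra hcon
              simp only [Set.mem_union, Set.mem_ofPred_eq, not_or, not_le, Real.dist_eq,
                abs_lt] at hcon
              linarith [hcon.1.1, hcon.1.2, hcon.2.1, hcon.2.2]
          _ ≤ _ := measure_union_le _ _
          _ ≤ 1 / 4 + 1 / 4 := add_le_add (hN m hm).1.le hN4.le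
          _ = 1 / 2 := by
              rw [← ENNReal.toReal_eq_toReal_iff' (by finiteness) (by finiteness)]
              rw [ENNReal.toReal_add (by finiteness) (by finiteness)]
              norm_num
      have hmeas : MeasurableSet ((fun ω => S m ω - S N ω) ⁻¹' Set.Iio (c / 2)) :=
        ((hSm m).sub (hSm N)) measurableSet_Iio
      rw [prob_compl_eq_one_sub hmeas] at hcompl
      have h1 := tsub_le_iff_right.1 hcompl
      have h2 : (1 / 2 : ℝ≥0∞) + 1 / 2 = 1 := by simpa using ENNReal.inv_two_add_inv_two
      nth_rewrite 1 [← h2] at h1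
      exact (ENNReal.add_le_add_iff_left (show (1 / 2 : ℝ≥0∞) ≠ ∞ by finiteness)).1 h1
    calc p * (1 / 2) ≤ p * P ((fun ω => S m ω - S N ω) ⁻¹' Set.Iio (c / 2)) := by gcongr
      _ = _ := hprod.symm
      _ ≤ _ := measure_mono fun ω hω => by
          have h1 : S N ω < -c := hω.1
          have h2 : S m ω - S N ω < c / 2 := hω.2
          change S m ω < -(c / 2)
          linarith
  -- As $X \ge 0$, a loss of more than $c/2$ keeps $S_m$ away from $X$. Convergence in probability
  -- then contradicts the lower bound $p/2$, which is uniform in $m$.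
  have hup : ∀ m, P {ω | S m ω < -(c / 2)} ≤ P {ω | c / 4 ≤ dist (S m ω) (X ω)} := by
    intro m
    refine measure_mono_ae ?_
    filter_upwards [h0] with ω hω h1
    have h1 : S m ω < -(c / 2) := h1
    change c / 4 ≤ dist (S m ω) (X ω)
    rw [dist_comm, Real.dist_eq]
    exact le_trans (by linarith) (le_abs_self _)
  have hpp : 0 < p * (1 / 2) := ENNReal.mul_pos hp.ne' (by norm_num)
  obtain ⟨m, hm, hmN⟩ := ((hX4.eventually_lt_const hpp).and (eventually_ge_atTop N)).exists
  exact absurd ((hlow m hmN).trans (hup m)) (not_le.2 hm)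

end

/-! ### The gains operator on $\ell_2$ and its $L^1$ estimates -/

section

variable {Ω : Type*} [MeasurableSpace Ω] {P : Measure Ω}
  {ε : ℕ → Ω → ℝ} {b : ℕ → ℝ}

/-- A source as an element of `L²(P)`. -/
noncomputable def StandardizedSources.source (hε : StandardizedSources P ε) (i : ℕ) : Lp ℝ 2 P :=
  (hε.square_integrable i).toLp (ε i)

theorem StandardizedSources.coeFn_source (hε : StandardizedSources P ε) (i : ℕ) :
    hε.source i =ᵐ[P] ε i :=
  (hε.square_integrable i).coeFn_toLp

theorem StandardizedSources.orthonormal_source (hε : StandardizedSources P ε) :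
    Orthonormal ℝ hε.source := by
  have hinner : ∀ i j, inner ℝ (hε.source i) (hε.source j) = ∫ ω, ε i ω * ε j ω ∂P := by
    intro i j
    rw [L2.inner_def]
    refine integral_congr_ae ?_
    filter_upwards [hε.coeFn_source i, hε.coeFn_source j] with ω h1 h2
    rw [h1, h2]
    simp [mul_comm]
  refine ⟨fun i => ?_, fun i j hij => ?_⟩
  · have h1 : ‖hε.source i‖ ^ 2 = 1 := by
      rw [← real_inner_self_eq_norm_sq, hinner, ← hε.second_moment i]
      simp only [sq]
    exact (pow_eq_one_iff_of_nonneg (norm_nonneg _) two_ne_zero).1 h1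
  · exact (hinner i j).trans (hε.integral_mul hij)

/-- The isometry `h ↦ ∑ i, h i * ε i` from `ℓ²` to `L²(P)`. -/
noncomputable def StandardizedSources.series (hε : StandardizedSources P ε) :
    lp (fun _ : ℕ => ℝ) 2 →ₗᵢ[ℝ] Lp ℝ 2 P :=
  hε.orthonormal_source.orthogonalFamily.linearIsometry

theorem StandardizedSources.hasSum_series (hε : StandardizedSources P ε)
    (h : lp (fun _ : ℕ => ℝ) 2) : HasSum (fun i => h i • hε.source i) (hε.series h) := by
  simpa using! hε.orthonormal_source.orthogonalFamily.hasSum_linearIsometry h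

theorem coeFn_sum_smul (f : ℕ → Lp ℝ 2 P) (g : ℕ → Ω → ℝ) (hfg : ∀ i, f i =ᵐ[P] g i)
    (h : ℕ → ℝ) (n : ℕ) :
    (∑ i ∈ Finset.range n, h i • f i : Lp ℝ 2 P) =ᵐ[P]
      fun ω => ∑ i ∈ Finset.range n, h i * g i ω := by
  induction n with
  | zero => simpa using! Lp.coeFn_zero ℝ 2 P
  | succ n ih =>
    rw [Finset.sum_range_succ]
    filter_upwards [Lp.coeFn_add (∑ i ∈ Finset.range n, h i • f i) (h n • f n), ih,
      Lp.coeFn_smul (h n) (f n), hfg n] with ω h1 h2 h3 h4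
    rw [h1, Pi.add_apply, h2, h3, Finset.sum_range_succ, Pi.smul_apply, h4, smul_eq_mul]

variable [IsProbabilityMeasure P]

theorem norm_const_one : ‖Lp.const 2 P (1 : ℝ)‖ = 1 := by
  rw [Lp.norm_const _ _ _ (by norm_num)]
  simp

/-- The gains `∑ i, h i * (ε i - b i)` of a strategy `h`. -/
noncomputable def StandardizedSources.gains (hε : StandardizedSources P ε)
    (b : lp (fun _ : ℕ => ℝ) 2) : lp (fun _ : ℕ => ℝ) 2 →L[ℝ] Lp ℝ 2 P :=
  hε.series.toContinuousLinearMap - (innerSL ℝ b).smulRight (Lp.const 2 P (1 : ℝ))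

theorem StandardizedSources.gains_apply (hε : StandardizedSources P ε)
    (b h : lp (fun _ : ℕ => ℝ) 2) :
    hε.gains b h = hε.series h - (inner ℝ b h : ℝ) • Lp.const 2 P (1 : ℝ) := rfl

theorem StandardizedSources.tendsto_sum_gains (hε : StandardizedSources P ε)
    (b h : lp (fun _ : ℕ => ℝ) 2) :
    Tendsto (fun n => ∑ i ∈ Finset.range n, h i • (hε.source i - b i • Lp.const 2 P (1 : ℝ)))
      atTop (𝓝 (hε.gains b h)) := by
  have h1 := (hε.hasSum_series h).tendsto_sum_nat
  have h2 := ((lp.hasSum_inner (𝕜 := ℝ) b h).tendsto_sum_nat).smul_const (Lp.const 2 P (1 : ℝ))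
  refine (h1.sub h2).congr fun n => ?_
  rw [Finset.sum_smul, ← Finset.sum_sub_distrib]
  refine Finset.sum_congr rfl fun i _ => ?_
  rw [smul_sub, smul_smul]
  simp

theorem StandardizedSources.coeFn_sum_gains (hε : StandardizedSources P ε)
    (b h : lp (fun _ : ℕ => ℝ) 2) (n : ℕ) :
    (∑ i ∈ Finset.range n, h i • (hε.source i - b i • Lp.const 2 P (1 : ℝ)) : Lp ℝ 2 P) =ᵐ[P]
      fun ω => ∑ i ∈ Finset.range n, h i * (ε i ω - b i) := by
  refine coeFn_sum_smul _ (fun i ω => ε i ω - b i) (fun i => ?_) h n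
  filter_upwards [Lp.coeFn_sub (hε.source i) (b i • Lp.const 2 P (1 : ℝ)),
    Lp.coeFn_smul (b i) (Lp.const 2 P (1 : ℝ)), Lp.coeFn_const (p := 2) (μ := P) (1 : ℝ),
    hε.coeFn_source i] with ω h1 h2 h3 h4
  rw [h1, Pi.sub_apply, h2, Pi.smul_apply, h3, h4]
  simp

/-- Replaces the limit of partial sums by a bounded linear map, to which weak convergence applies.
-/
theorem StandardizedSources.isValue_iff (hε : StandardizedSources P ε)
    (b h : lp (fun _ : ℕ => ℝ) 2) (z : ℝ) (V : Lp ℝ 2 P) :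
    IsValue P ε b z h V ↔ V = Lp.const 2 P z + hε.gains b h := by
  have hlim := (hε.tendsto_sum_gains b h).const_add (Lp.const 2 P z)
  have hiff : IsValue P ε b z h V ↔ Tendsto (fun n => Lp.const 2 P z +
      ∑ i ∈ Finset.range n, h i • (hε.source i - b i • Lp.const 2 P (1 : ℝ))) atTop (𝓝 V) := by
    rw [IsValue, tendsto_iff_edist_tendsto_0]
    refine tendsto_congr fun n => ?_
    rw [Lp.edist_def]
    refine eLpNorm_congr_ae ?_
    filter_upwards [Lp.coeFn_add (Lp.const 2 P z)
      (∑ i ∈ Finset.range n, h i • (hε.source i - b i • Lp.const 2 P (1 : ℝ))),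
      hε.coeFn_sum_gains b h n, Lp.coeFn_const (p := 2) (μ := P) z] with ω h1 h2 h3
    rw [Pi.sub_apply, h1, Pi.add_apply, h2, h3]
    rfl
  rw [hiff]
  exact ⟨fun hV => tendsto_nhds_unique hV hlim, fun hV => hV ▸ hlim⟩

theorem StandardizedSources.eq_zero_of_gains_nonneg (hε : StandardizedSources P ε)
    {b : lp (fun _ : ℕ => ℝ) 2} (hna : NoSourceArbitrage P ε b) {h : lp (fun _ : ℕ => ℝ) 2}
    (h0 : ∀ᵐ ω ∂P, 0 ≤ hε.gains b h ω) : h = 0 := by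
  have hlim := tendstoInMeasure_of_tendsto_Lp (hε.tendsto_sum_gains b h)
  have := hε.eq_zero_of_nonneg hna h
    (hlim.congr_left fun n => hε.coeFn_sum_gains b h n) h0
  ext i
  exact this i

theorem lipschitz_integral_abs (f g : Lp ℝ 2 P) :
    |∫ ω, |f ω| ∂P - ∫ ω, |g ω| ∂P| ≤ ‖f - g‖ := by
  have hint : ∀ w : Lp ℝ 2 P, Integrable (w : Ω → ℝ) P := fun w =>
    (Lp.memLp w).integrable (by norm_num)
  rw [← integral_sub (hint f).abs (hint g).abs]
  refine (abs_integral_le_integral_abs).trans ?_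
  refine le_trans ?_ (integral_abs_le_of_integral_sq_le (Lp.memLp (f - g)) (norm_nonneg _)
    (integral_sq_eq_norm_sq (f - g)).le)
  refine integral_mono_ae ((hint f).abs.sub (hint g).abs).abs (hint (f - g)).abs ?_
  filter_upwards [Lp.coeFn_sub f g] with ω hω
  rw [hω]
  exact abs_abs_sub_abs_le _ _

theorem continuous_integral_abs : Continuous fun f : Lp ℝ 2 P => ∫ ω, |f ω| ∂P := by
  refine LipschitzWith.continuous (K := 1) (LipschitzWith.of_dist_le_mul fun f g => ?_)
  rw [Real.dist_eq, dist_eq_norm, NNReal.coe_one, one_mul]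
  exact lipschitz_integral_abs f g

/-- The inequality for finite sums passes to the limit because $f \mapsto E|f|$ is continuous on
$L^2$. -/
theorem StandardizedSources.norm_le_integral_abs_series (hε : StandardizedSources P ε) {M : ℝ}
    (hM0 : 0 ≤ M) (hM : ∀ i, MemLp (ε i) 3 P ∧ ∫ ω, |ε i ω| ^ 3 ∂P ≤ M)
    (h : lp (fun _ : ℕ => ℝ) 2) : ‖h‖ ≤ (3 + M) * ∫ ω, |hε.series h ω| ∂P := by
  have h1 := ((continuous_integral_abs.tendsto _).comp
    (hε.hasSum_series h).tendsto_sum_nat).const_mul (3 + M)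
  have h2 : Tendsto (fun n => √(∑ i ∈ Finset.range n, h i ^ 2)) atTop (𝓝 ‖h‖) := by
    have h3 := (lp.hasSum_inner (𝕜 := ℝ) h h).tendsto_sum_nat
    rw [real_inner_self_eq_norm_sq] at h3
    have h4 := (Real.continuous_sqrt.tendsto _).comp h3
    rw [Real.sqrt_sq (norm_nonneg h)] at h4
    refine h4.congr fun n => ?_
    simp [sq]
  refine le_of_tendsto_of_tendsto' h2 h1 fun n => ?_
  refine (hε.sqrt_sum_sq_le_integral_abs hM0 hM h n).trans_eq ?_
  simp only [Function.comp_apply]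
  congr 1
  refine integral_congr_ae ?_
  filter_upwards [coeFn_sum_smul _ _ hε.coeFn_source h n] with ω hω
  rw [hω]

theorem StandardizedSources.integral_gains (hε : StandardizedSources P ε)
    (b h : lp (fun _ : ℕ => ℝ) 2) : ∫ ω, hε.gains b h ω ∂P = -inner ℝ b h := by
  have hint : ∀ w : Lp ℝ 2 P, ∫ ω, w ω ∂P = inner ℝ (Lp.const 2 P (1 : ℝ)) w := by
    intro w
    rw [L2.inner_def]
    refine integral_congr_ae ?_
    filter_upwards [Lp.coeFn_const (p := 2) (μ := P) (1 : ℝ)] with ω hω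
    rw [hω]
    simp
  have h0 : ∀ i, inner ℝ (Lp.const 2 P (1 : ℝ)) (hε.source i) = 0 := by
    intro i
    rw [← hint, integral_congr_ae (hε.coeFn_source i), hε.mean_zero]
  have h1 : inner ℝ (Lp.const 2 P (1 : ℝ)) (hε.series h) = 0 := by
    have h2 := (hε.hasSum_series h).mapL (innerSL ℝ (Lp.const 2 P (1 : ℝ)))
    simp only [map_smul, innerSL_apply_apply, h0, smul_zero] at h2
    exact h2.unique hasSum_zero
  rw [hint, hε.gains_apply, inner_sub_right, h1, inner_smul_right, real_inner_self_eq_norm_sq,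
    norm_const_one]
  simp

/-- Combines $|x| = 2x^- + x$ with $E\,G(h) = -\langle b, h\rangle$; the last term is the cost of
passing from the gains to the centred series. Thus small negative parts and a small $\langle b,
h\rangle$ make the series small in $L^1$. -/
theorem StandardizedSources.integral_abs_series_le (hε : StandardizedSources P ε)
    (b h : lp (fun _ : ℕ => ℝ) 2) :
    ∫ ω, |hε.series h ω| ∂P ≤
      2 * (∫ ω, max (-hε.gains b h ω) 0 ∂P) - inner ℝ b h + |inner ℝ b h| := by
  have h1 := (abs_le.1 (lipschitz_integral_abs (hε.series h) (hε.gains b h))).2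
  have h2 : hε.series h - hε.gains b h = (inner ℝ b h : ℝ) • Lp.const 2 P (1 : ℝ) := by
    rw [hε.gains_apply]
    abel
  rw [h2, norm_smul, norm_const_one, mul_one, Real.norm_eq_abs] at h1
  have hint : Integrable (hε.gains b h : Ω → ℝ) P := (Lp.memLp _).integrable (by norm_num)
  have h3 : ∫ ω, |hε.gains b h ω| ∂P =
      2 * (∫ ω, max (-hε.gains b h ω) 0 ∂P) + ∫ ω, hε.gains b h ω ∂P := by
    have hneg : Integrable (fun ω => max (-hε.gains b h ω) 0) P := hint.neg.pos_part
    rw [← integral_const_mul, ← integral_add (hneg.const_mul 2) hint]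
    congr 1
    ext ω
    rcases le_total (hε.gains b h ω) 0 with h | h
    · rw [abs_of_nonpos h, max_eq_left (by linarith)]; ring
    · rw [abs_of_nonneg h, max_eq_right (by linarith)]; ring
  rw [hε.integral_gains] at h3
  linarith

/-! ### Boundedness of strategies and closedness -/

/-- Weak convergence of strategies implies weak convergence of their gains. -/
theorem StandardizedSources.tendsto_inner_gains (hε : StandardizedSources P ε)
    (b : lp (fun _ : ℕ => ℝ) 2) {l : Filter ℕ} {h : ℕ → lp (fun _ : ℕ => ℝ) 2}
    {g : lp (fun _ : ℕ => ℝ) 2}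
    (hg : ∀ y, Tendsto (fun n => inner ℝ (h n) y) l (𝓝 (inner ℝ g y))) (y : Lp ℝ 2 P) :
    Tendsto (fun n => inner ℝ (hε.gains b (h n)) y) l (𝓝 (inner ℝ (hε.gains b g) y)) := by
  simp only [← ContinuousLinearMap.adjoint_inner_right]
  exact hg _

/-- Bounded strategies whose gains have almost surely vanishing lower bounds tend to zero in norm. -/
theorem StandardizedSources.tendsto_norm_zero_of_gains_ge (hε : StandardizedSources P ε)
    (b : lp (fun _ : ℕ => ℝ) 2) (hna : NoSourceArbitrage P ε b) (h3 : BoundedThirdMoments P ε)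
    {g : ℕ → lp (fun _ : ℕ => ℝ) 2} {r : ℕ → Lp ℝ 2 P}
    (hle : ∀ n, ∀ᵐ ω ∂P, r n ω ≤ hε.gains b (g n) ω)
    (hr : ∀ᵐ ω ∂P, Tendsto (fun n => r n ω) atTop (𝓝 0)) (hg : ∀ n, ‖g n‖ ≤ 1) :
    Tendsto (fun n => ‖g n‖) (hyperfilter ℕ : Ultrafilter ℕ) (𝓝 0) := by
  obtain ⟨M, hM0, hM⟩ := h3.exists_bound hε
  -- A free ultrafilter supplies the weak limit without extracting a subsequence; since it refines
  -- `atTop`, ordinary limits carry over to it.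
  obtain ⟨a, ha⟩ := exists_weak_limit (hyperfilter ℕ) g hg
  have hU : ((hyperfilter ℕ : Ultrafilter ℕ) : Filter ℕ) ≤ atTop := Nat.hyperfilter_le_atTop
  have hr' : ∀ᵐ ω ∂P, Tendsto (fun n => r n ω) atTop (𝓝 ((0 : Lp ℝ 2 P) ω)) := by
    filter_upwards [hr, Lp.coeFn_zero ℝ 2 P] with ω h1 h2
    simpa [h2] using h1
  have ha0 : a = 0 := by
    refine hε.eq_zero_of_gains_nonneg hna ?_
    filter_upwards [ae_le_of_weak_limit hU hle hr' (hε.tendsto_inner_gains b ha),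
      Lp.coeFn_zero ℝ 2 P] with ω h1 h2
    simpa [h2] using h1
  have hb : Tendsto (fun n => inner ℝ b (g n)) (hyperfilter ℕ : Ultrafilter ℕ) (𝓝 (0 : ℝ)) := by
    have := ha b
    rw [ha0, inner_zero_left] at this
    simpa only [real_inner_comm] using this
  have hneg := (tendsto_integral_negPart (R := ‖hε.gains b‖)
    (fun n => (hε.gains b).unit_le_opNorm _ (hg n)) hle hr).mono_left hU
  have hlim := ((((hneg.const_mul 2).sub hb).add hb.abs).const_mul (3 + M))
  simp only [mul_zero, sub_zero, abs_zero, add_zero] at hlim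
  refine squeeze_zero (fun n => norm_nonneg _) (fun n => ?_) hlim
  refine (hε.norm_le_integral_abs_series hM0 hM (g n)).trans ?_
  have := hε.integral_abs_series_le b (g n)
  gcongr

/-- Strategies whose gains dominate an almost surely convergent sequence do not escape to
infinity. -/
theorem StandardizedSources.not_tendsto_norm_atTop (hε : StandardizedSources P ε)
    (b : lp (fun _ : ℕ => ℝ) 2) (hna : NoSourceArbitrage P ε b) (h3 : BoundedThirdMoments P ε)
    {h : ℕ → lp (fun _ : ℕ => ℝ) 2} {θ : ℕ → Lp ℝ 2 P} {η : Ω → ℝ}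
    (hle : ∀ n, ∀ᵐ ω ∂P, θ n ω ≤ hε.gains b (h n) ω)
    (hθ : ∀ᵐ ω ∂P, Tendsto (fun n => θ n ω) atTop (𝓝 (η ω))) :
    ¬ Tendsto (fun n => ‖h n‖) atTop atTop := by
  intro htop
  have h1 : Tendsto (fun n => ‖‖h n‖⁻¹ • h n‖) (hyperfilter ℕ : Ultrafilter ℕ) (𝓝 0) := by
    refine hε.tendsto_norm_zero_of_gains_ge b hna h3 (r := fun n => ‖h n‖⁻¹ • θ n) (fun n => ?_) ?_ fun n => ?_
    · rw [map_smul]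
      filter_upwards [hle n, Lp.coeFn_smul ‖h n‖⁻¹ (θ n),
        Lp.coeFn_smul ‖h n‖⁻¹ (hε.gains b (h n))] with ω e1 e2 e3
      rw [e2, e3]
      exact mul_le_mul_of_nonneg_left e1 (by positivity)
    · filter_upwards [hθ, ae_all_iff.2 fun n => Lp.coeFn_smul ‖h n‖⁻¹ (θ n)] with ω e1 e2
      simp only [e2, Pi.smul_apply, smul_eq_mul]
      simpa using (tendsto_inv_atTop_zero.comp htop).mul e1
    · rw [norm_smul, norm_inv, norm_norm]
      -- This covers `h n = 0` too, since `0⁻¹ = 0`.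
      exact inv_mul_le_one
  have h2 : Tendsto (fun n => ‖‖h n‖⁻¹ • h n‖) (hyperfilter ℕ : Ultrafilter ℕ) (𝓝 1) := by
    refine tendsto_const_nhds.congr' ?_
    filter_upwards [Nat.hyperfilter_le_atTop (htop.eventually_gt_atTop 0)] with n hn
    rw [norm_smul, norm_inv, norm_norm, inv_mul_cancel₀ (ne_of_gt hn)]
  exact zero_ne_one (tendsto_nhds_unique h1 h2)

/-- The discarded amount $\kappa$ is exactly the slack in the inequality, so it need not be tracked
through limits. -/
theorem StandardizedSources.mem_attainableWithDisposal_iff (hε : StandardizedSources P ε)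
    (b : lp (fun _ : ℕ => ℝ) 2) (z : ℝ) (X : Lp ℝ 2 P) :
    X ∈ attainableWithDisposal P ε b z ↔
      ∃ h, ∀ᵐ ω ∂P, (X - Lp.const 2 P z) ω ≤ hε.gains b h ω := by
  have key : ∀ h, (∀ᵐ ω ∂P, (X - Lp.const 2 P z) ω ≤ hε.gains b h ω) ↔
      Lp.const 2 P z + hε.gains b h - X ∈ nonnegL2 P := by
    intro h
    refine eventually_congr ?_
    filter_upwards [Lp.coeFn_sub X (Lp.const 2 P z),
      Lp.coeFn_sub (Lp.const 2 P z + hε.gains b h) X,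
      Lp.coeFn_add (Lp.const 2 P z) (hε.gains b h)] with ω e1 e2 e3
    rw [e1, e2, Pi.sub_apply, Pi.sub_apply, e3, Pi.add_apply]
    constructor <;> intro <;> linarith
  simp only [key]
  constructor
  · rintro ⟨V, ⟨h, hV⟩, κ, hκ, rfl⟩
    rw [hε.isValue_iff] at hV
    refine ⟨h, ?_⟩
    rwa [hV, sub_sub_cancel]
  · rintro ⟨h, hh⟩
    exact ⟨_, ⟨h, (hε.isValue_iff b h z _).2 rfl⟩, _, hh, sub_sub_cancel _ _⟩

end

end LargeMarket

theorem corollary1 {Ω : Type*} [MeasurableSpace Ω] (P : Measure Ω) [IsProbabilityMeasure P]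
    (ε : ℕ → Ω → ℝ) (b : ℕ → ℝ)
    (hε : LargeMarket.StandardizedSources P ε)
    (hb : Memℓp b 2)
    (hna : LargeMarket.NoSourceArbitrage P ε b)
    (h3 : LargeMarket.BoundedThirdMoments P ε)
    (z : ℝ) :
    LargeMarket.ClosedInProbability P (LargeMarket.attainableWithDisposal P ε b z) := by
  intro X Y hX hXY
  obtain ⟨b, rfl⟩ : ∃ b' : lp (fun _ : ℕ => ℝ) 2, (b' : ℕ → ℝ) = b := ⟨⟨b, hb⟩, rfl⟩
  simp only [hε.mem_attainableWithDisposal_iff] at hX ⊢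
  choose h hh using hX
  obtain ⟨φ, -, hφ⟩ := hXY.exists_seq_tendsto_ae
  have hlim : ∀ᵐ ω ∂P, Tendsto (fun n => (X (φ n) - Lp.const 2 P z : Lp ℝ 2 P) ω) atTop
      (𝓝 ((Y - Lp.const 2 P z : Lp ℝ 2 P) ω)) := by
    filter_upwards [hφ, ae_all_iff.2 fun n => Lp.coeFn_sub (X (φ n)) (Lp.const 2 P z),
      Lp.coeFn_sub Y (Lp.const 2 P z)] with ω e1 e2 e3
    simp only [e2, e3, Pi.sub_apply]
    exact e1.sub_const _
  have hnot := hε.not_tendsto_norm_atTop b hna h3 (fun n => hh (φ n)) hlim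
  -- Failure of divergence bounds the norms by some `R` for infinitely many indices, hence along a
  -- subsequence `ψ`.
  rw [tendsto_atTop] at hnot
  push Not at hnot
  obtain ⟨R, hR⟩ := hnot
  obtain ⟨ψ, hψ, hψR⟩ := extraction_of_frequently_atTop hR
  obtain ⟨g, hg⟩ := LargeMarket.exists_weak_limit (hyperfilter ℕ) (fun n => h (φ (ψ n)))
    fun n => (hψR n).le
  refine ⟨g, LargeMarket.ae_le_of_weak_limit Nat.hyperfilter_le_atTop
    (fun n => hh (φ (ψ n))) ?_ (hε.tendsto_inner_gains b hg)⟩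
  filter_upwards [hlim] with ω hω
  exact hω.comp hψ.tendsto_atTop
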